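/- For every $\delta>0$ there exists $\sigma_0=\sigma_0(\delta)>0$, depending only on $\delta$, with the following property. Let $X$ be a metric length space (the distance between two points is the infimum of the lengths of the paths joining them) that is $\delta$-hyperbolic, i.e. for all $x,y,z,t\in X$, $$\langle x,z\rangle_t\ \ge\ \min\{\langle x,y\rangle_t,\langle y,z\rangle_t\}-\delta,\qquad\text{where } \langle x,y\rangle_t=\tfrac12\big(|x-t|+|y-t|-|x-y|\big),$$ and $|x-y|$ denotes the distance. Let $G$ be a group acting on $X$ by isometries. ($X$ is not assumed to be geodesic or proper, and nothing else is assumed about the action.) Write $B(x,r)$ for the closed ball of center $x$ and radius $r$, and $\mathrm{Stab}(v)$ for the stabilizer of $v$ in $G$. Let $\sigma\ge\sigma_0$ and let $\mathcal R$ be a $\sigma$-rotation family, i.e. a collection of pairs $(H,v)$, with $H$ a subgroup of $G$ and $v\in X$, such that 1. for every $(H,v)\in\mathcal R$, $H\le \mathrm{Stab}(v)$, and $|hx-x|=2|v-x|$ for every $x\in B(v,\sigma/10)$ and every $h\in H\setminus\{1\}$; 2. for all distinct $(H,v),(H',v')\in\mathcal R$, $|v-v'|\ge\sigma$; 3. for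 every $g\in G$ and every $(H,v)\in\mathcal R$, $(gHg^{-1},gv)\in\mathcal R$. Let $K$ be the subgroup of $G$ generated by all the subgroups $H$ with $(H,v)\in\mathcal R$ for some $v\in X$. Then for every $(H,v)\in\mathcal R$ we have $\mathrm{Stab}(v)\cap K=H$. Moreover, for every $x\in B(v,\sigma/5)$ and every $g\in K\setminus H$, we have $|gx-x|>3\sigma/5$. -/

import Mathlib

namespace RotationFamilies

/-- A metric space is a length space if the distance between any two points is the infimum of the
lengths (total variations) of the continuous paths joining them. -/
def IsLengthSpace (X : Type*) [MetricSpace X] : Prop :=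
  ∀ x y : X, edist x y = ⨅ γ : Path x y, eVariationOn γ Set.univ

/-- The Gromov product `⟨x, y⟩_z`. -/
noncomputable def gromovProduct {X : Type*} [MetricSpace X] (x y z : X) : ℝ :=
  (dist x z + dist y z - dist x y) / 2

/-- The four points condition: `X` is `δ`-hyperbolic. -/
def IsHyperbolic (X : Type*) [MetricSpace X] (δ : ℝ) : Prop :=
  ∀ x y z t : X,
    min (gromovProduct x y t) (gromovProduct y z t) - δ ≤ gromovProduct x z t

/-- A `σ`-rotation family: a collection `R` of pairs `(H, v)`, with `H` a subgroup of `G` and `v` a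
point of `X`. -/
structure IsRotationFamily {G X : Type*} [Group G] [MetricSpace X] [MulAction G X]
    (σ : ℝ) (R : Set (Subgroup G × X)) : Prop where
  le_stabilizer : ∀ p ∈ R, p.1 ≤ MulAction.stabilizer G p.2
  large_angle : ∀ p ∈ R, ∀ x ∈ Metric.closedBall p.2 (σ / 10), ∀ h ∈ p.1, h ≠ 1 →
    dist (h • x) x = 2 * dist p.2 x
  apices_apart : ∀ p ∈ R, ∀ q ∈ R, p ≠ q → σ ≤ dist p.2 q.2
  invariant : ∀ g : G, ∀ p ∈ R, (p.1.map (MulAut.conj g).toMonoidHom, g • p.2) ∈ R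

/-- The subgroup of `G` generated by all the rotation groups of `R`. -/
def rotationSubgroup {G X : Type*} [Group G] (R : Set (Subgroup G × X)) : Subgroup G :=
  Subgroup.closure (⋃ p ∈ R, (p.1 : Set G))

end RotationFamilies

/-! Everything follows from one dichotomy: an element of $K$ lies in $H$ or moves $v$ by more than
$\sigma$ (`IsRotationFamily.mem_or_lt_dist`). It is proved with Gromov's windmills, reading $\langle
a,b\rangle_u$ as the distance from $u$ to a geodesic $[a,b]$. Starting from $(H,\{v\})$, a windmill
$(L,A)$ grows by adding to $L$ the rotations whose apices come within $100\delta$ of $A$, and by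
thickening the orbit of $A$. Each new element is in $L$ or is a product of rotations about distinct
consecutive apices (`mem_or_reducedWord`). Rotations turn by a large angle and apices are $\sigma$
apart, so the path following such a word is almost geodesic. Hence the word moves $v$ far
(`ReducedWord.lt_dist_smul`), and unswallowed apices stay away from the enlarged set
(`ReducedWord.lt_gromovProduct`, `IsWindmill.next`). The windmills exhaust $X$, so they eventually
contain any given element of $K$. -/

namespace RotationFamilies

/-! ### Gromov products and hyperbolicity without geodesics. -/

section Metric

variable {X : Type*} [MetricSpace X]

/-- In a length space there are points that almost lie between two given points. -/
theorem IsLengthSpace.exists_between (hX : IsLengthSpace X) (x y : X) {t : ℝ} (ht : 0 ≤ t)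
    (hty : t ≤ dist x y) {η : ℝ} (hη : 0 < η) :
    ∃ p, dist x p = t ∧ dist p y ≤ dist x y - t + η := by
  have hlt : (⨅ γ : Path x y, eVariationOn γ Set.univ) < edist x y + ENNReal.ofReal η := by
    rw [← hX x y]
    exact ENNReal.lt_add_right (edist_ne_top x y) (by simpa using hη)
  obtain ⟨γ, hγ⟩ := iInf_lt_iff.1 hlt
  have hcont : Continuous fun s => dist x (γ s) := by fun_prop
  obtain ⟨s, hs⟩ : t ∈ Set.range fun s => dist x (γ s) :=
    mem_range_of_exists_le_of_exists_ge hcont ⟨0, by simpa using ht⟩ ⟨1, by simpa using hty⟩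
  refine ⟨γ s, hs, ?_⟩
  have h1 : edist x (γ s) ≤ eVariationOn γ (Set.Icc 0 s) := by
    simpa using eVariationOn.edist_le γ (s := Set.Icc 0 s) (x := 0) (y := s)
      ⟨le_rfl, s.2.1⟩ ⟨s.2.1, le_rfl⟩
  have h2 : edist (γ s) y ≤ eVariationOn γ (Set.Icc s 1) := by
    simpa using eVariationOn.edist_le γ (s := Set.Icc s 1) (x := s) (y := 1)
      ⟨le_rfl, s.2.2⟩ ⟨s.2.2, le_rfl⟩
  have h3 : edist x (γ s) + edist (γ s) y ≤ edist x y + ENNReal.ofReal η :=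
    (add_le_add h1 h2).trans ((eVariationOn.add_le_union γ
      fun a ha b hb => ha.2.trans hb.1).trans ((eVariationOn.mono γ (Set.subset_univ _)).trans hγ.le))
  simp only [edist_dist] at h3
  rw [← ENNReal.ofReal_add dist_nonneg dist_nonneg, ← ENNReal.ofReal_add dist_nonneg hη.le,
    ENNReal.ofReal_le_ofReal_iff (by positivity)] at h3
  simp only at hs
  linarith

theorem gromovProduct_comm (x y z : X) : gromovProduct x y z = gromovProduct y x z := by
  simp only [gromovProduct, dist_comm x y]
  ring

@[simp]
theorem gromovProduct_self (x z : X) : gromovProduct x x z = dist x z := by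
  simp [gromovProduct]

/-- Used for apices $x$, $z$, which are $\sigma$ apart: a small product based at one forces a large
product based at the other. -/
theorem gromovProduct_add_gromovProduct (x y z : X) :
    gromovProduct x y z + gromovProduct z y x = dist x z := by
  simp only [gromovProduct, dist_comm y x, dist_comm z x, dist_comm z y]
  ring

theorem gromovProduct_sub_dist_le (a b p q z : X) :
    gromovProduct a b z - dist p a - dist q b ≤ gromovProduct p q z := by
  simp only [gromovProduct]
  have h1 := dist_triangle a p z
  have h2 := dist_triangle b q z
  have h3 := dist_triangle4 p a b q
  rw [dist_comm a p] at h1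
  rw [dist_comm b q] at h2 h3
  linarith

theorem gromovProduct_smul {G : Type*} [Group G] [MulAction G X] [IsIsometricSMul G X]
    (g : G) (x y z : X) :
    gromovProduct (g • x) (g • y) (g • z) = gromovProduct x y z := by
  simp [gromovProduct]

theorem gromovProduct_smul_eq {G : Type*} [Group G] [MulAction G X] [IsIsometricSMul G X]
    (g : G) (x y z : X) :
    gromovProduct (g • x) y z = gromovProduct x (g⁻¹ • y) (g⁻¹ • z) := by
  rw [← gromovProduct_smul g x, smul_inv_smul, smul_inv_smul]

theorem IsHyperbolic.le_or_le {δ : ℝ} (h : IsHyperbolic X δ) (x y z t : X) :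
    gromovProduct x y t ≤ gromovProduct x z t + δ ∨
      gromovProduct y z t ≤ gromovProduct x z t + δ := by
  have := h x y z t
  rcases min_choice (gromovProduct x y t) (gromovProduct y z t) with h' | h' <;> rw [h'] at this
  · left; linarith
  · right; linarith

/-- A point `u` close to a geodesic `[a, b]` is close to a geodesic from `z` to `a` or to `b`. -/
theorem IsHyperbolic.exists_shadow {δ r : ℝ} (h : IsHyperbolic X δ) {a b u : X}
    (hu : gromovProduct a b u ≤ r) (z : X) :
    dist u z - (r + δ) ≤ gromovProduct u a z ∨ dist u z - (r + δ) ≤ gromovProduct u b z := by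
  have ha := gromovProduct_add_gromovProduct u a z
  have hb := gromovProduct_add_gromovProduct u b z
  rw [gromovProduct_comm z a u] at ha
  rcases h.le_or_le a z b u with h' | h'
  · left; linarith
  · right; linarith

end Metric

/-! ### Normal forms in the subgroup of the next windmill. -/

section Word

variable {G X : Type*} [Group G]

/-- The subgroup of the next windmill. -/
def nextSubgroup (L : Subgroup G) (N : Set (Subgroup G × X)) : Subgroup G :=
  Subgroup.closure ((L : Set G) ∪ ⋃ p ∈ N, (p.1 : Set G))

theorem le_nextSubgroup (L : Subgroup G) (N : Set (Subgroup G × X)) : L ≤ nextSubgroup L N :=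
  fun _ hg => Subgroup.subset_closure (Or.inl hg)

theorem le_nextSubgroup_of_mem (L : Subgroup G) {N : Set (Subgroup G × X)} {p : Subgroup G × X}
    (hp : p ∈ N) : p.1 ≤ nextSubgroup L N :=
  fun _ hg => Subgroup.subset_closure (Or.inr (Set.mem_biUnion hp hg))

/-- Products `h₁ ⋯ hₙ w` with `n ≥ 1`, where `w ∈ L` and the `hᵢ` are non-trivial rotations around
apices of `N`, consecutive ones being distinct. The first pair is recorded. -/
inductive ReducedWord (L : Subgroup G) (N : Set (Subgroup G × X)) : Subgroup G × X → G → Prop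
  | single {p h w} : p ∈ N → h ∈ p.1 → h ≠ 1 → w ∈ L → ReducedWord L N p (h * w)
  | cons {p h q g} : p ∈ N → h ∈ p.1 → h ≠ 1 → q ≠ p → ReducedWord L N q g →
      ReducedWord L N p (h * g)

theorem ReducedWord.mem {L : Subgroup G} {N : Set (Subgroup G × X)} {p : Subgroup G × X} {g : G}
    (h : ReducedWord L N p g) : p ∈ N := by
  cases h <;> assumption

variable [MulAction G X]

/-- The action by conjugation on pairs consisting of a subgroup and a point. -/
def conjPair (g : G) (p : Subgroup G × X) : Subgroup G × X :=
  (p.1.map (MulAut.conj g).toMonoidHom, g • p.2)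

theorem conj_mem_conjPair {g h : G} {p : Subgroup G × X} (hh : h ∈ p.1) :
    g * h * g⁻¹ ∈ (conjPair g p).1 :=
  ⟨h, hh, rfl⟩

theorem le_of_conjPair_le {L : Subgroup G} {g : G} (hg : g ∈ L) {p : Subgroup G × X}
    (h : (conjPair g p).1 ≤ L) : p.1 ≤ L := by
  intro k hk
  have h1 : g * k * g⁻¹ ∈ L := h (conj_mem_conjPair hk)
  have h2 := L.mul_mem (L.mul_mem (L.inv_mem hg) h1) hg
  simpa [mul_assoc] using h2

theorem conjPair_injective (g : G) : Function.Injective (conjPair (X := X) g) := by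
  rintro ⟨H, v⟩ ⟨H', v'⟩ h
  simp only [conjPair, Prod.mk.injEq] at h
  have h1 : Function.Injective (MulAut.conj g).toMonoidHom := (MulAut.conj g).injective
  exact Prod.ext (Subgroup.map_injective h1 h.1) (smul_left_cancel g h.2)

/-- Pushing `u` to the right through the word conjugates every rotation, and `u` is finally absorbed
by the last factor. -/
theorem ReducedWord.smul {L : Subgroup G} {N : Set (Subgroup G × X)}
    (hN : ∀ w ∈ L, ∀ p ∈ N, conjPair w p ∈ N) {u : G} (hu : u ∈ L) {p : Subgroup G × X} {g : G}
    (h : ReducedWord L N p g) : ReducedWord L N (conjPair u p) (u * g) := by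
  have hne {k : G} (hk : k ≠ 1) : u * k * u⁻¹ ≠ 1 := by simpa using hk
  induction h with
  | @single p h w hp hh h1 hw =>
    rw [show u * (h * w) = u * h * u⁻¹ * (u * w) by group]
    exact .single (hN u hu p hp) (conj_mem_conjPair hh) (hne h1) (L.mul_mem hu hw)
  | @cons p h q g hp hh h1 hqp _ ih =>
    rw [show u * (h * g) = u * h * u⁻¹ * (u * g) by group]
    exact .cons (hN u hu p hp) (conj_mem_conjPair hh) (hne h1)
      (fun e => hqp (conjPair_injective u e)) ih

/-- Left multiplication by a generator preserves the normal form: elements of `L` slide to the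
right, and a rotation is put in front or merged with a first letter of the same pair, which may
cancel. -/
theorem mem_or_reducedWord {L : Subgroup G} {N : Set (Subgroup G × X)}
    (hN : ∀ w ∈ L, ∀ p ∈ N, conjPair w p ∈ N) {g : G} (hg : g ∈ nextSubgroup L N) :
    g ∈ L ∨ ∃ p, ReducedWord L N p g := by
  have key : ∀ x ∈ (L : Set G) ∪ ⋃ p ∈ N, (p.1 : Set G), ∀ y : G,
      (y ∈ L ∨ ∃ p, ReducedWord L N p y) → (x * y ∈ L ∨ ∃ p, ReducedWord L N p (x * y)) := by
    rintro x (hx | hx) y hy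
    · rcases hy with hy | ⟨p, hy⟩
      · exact Or.inl (L.mul_mem hx hy)
      · exact Or.inr ⟨_, hy.smul hN hx⟩
    · simp only [Set.mem_iUnion] at hx
      obtain ⟨p, hp, hx⟩ := hx
      by_cases hx1 : x = 1
      · simpa [hx1] using hy
      rcases hy with hy | ⟨q, hy⟩
      · exact Or.inr ⟨p, .single hp hx hx1 hy⟩
      by_cases hqp : q = p
      · subst hqp
        cases hy with
        | @single _ h w _ hh h1 hw =>
          rw [← mul_assoc]
          by_cases hxh : x * h = 1
          · left; simpa [hxh] using hw
          · exact Or.inr ⟨q, .single hp (q.1.mul_mem hx hh) hxh hw⟩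
        | @cons _ h q' g' _ hh h1 hne hw =>
          rw [← mul_assoc]
          by_cases hxh : x * h = 1
          · right; exact ⟨q', by simpa [hxh] using hw⟩
          · exact Or.inr ⟨q, .cons hp (q.1.mul_mem hx hh) hxh hne hw⟩
      · exact Or.inr ⟨p, .cons hp hx hx1 hqp hy⟩
  refine Subgroup.closure_induction_left (p := fun g _ => g ∈ L ∨ ∃ p, ReducedWord L N p g)
    (Or.inl L.one_mem) (fun x hx y _ hy => key x hx y hy) (fun x hx y _ hy => ?_) hg
  refine key x⁻¹ ?_ y hy
  rcases hx with hx | hx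
  · exact Or.inl (L.inv_mem hx)
  · simp only [Set.mem_iUnion] at hx
    obtain ⟨p, hp, hx⟩ := hx
    exact Or.inr (Set.mem_biUnion hp (p.1.inv_mem hx))

end Word

/-! ### Windmills and the large angle of rotations. -/

section Rotation

variable {G X : Type*} [Group G] [MetricSpace X] [MulAction G X]

variable {σ δ : ℝ} {R : Set (Subgroup G × X)}

theorem IsRotationFamily.smul_apex (hR : IsRotationFamily σ R) {p : Subgroup G × X} (hp : p ∈ R)
    {h : G} (hh : h ∈ p.1) : h • p.2 = p.2 :=
  hR.le_stabilizer p hp hh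

theorem IsRotationFamily.conjPair_mem (hR : IsRotationFamily σ R) {p : Subgroup G × X} (hp : p ∈ R)
    (g : G) : conjPair g p ∈ R :=
  hR.invariant g p hp

/-- A windmill: a set `A` invariant under a subgroup `L`, such that the apices whose rotation group
is not contained in `L` are far from all geodesics between points of `A`. -/
structure IsWindmill (δ : ℝ) (R : Set (Subgroup G × X)) (L : Subgroup G) (A : Set X) : Prop where
  smul_mem : ∀ g ∈ L, ∀ a ∈ A, g • a ∈ A
  le_or_far : ∀ p ∈ R, p.1 ≤ L ∨ ∀ a ∈ A, ∀ b ∈ A, 40 * δ ≤ gromovProduct a b p.2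

/-- The pairs that are swallowed by the next windmill. -/
def nearPairs (δ : ℝ) (R : Set (Subgroup G × X)) (L : Subgroup G) (A : Set X) :
    Set (Subgroup G × X) :=
  {p ∈ R | ¬ p.1 ≤ L ∧ ∃ a ∈ A, ∃ b ∈ A, gromovProduct a b p.2 < 100 * δ}

variable {L : Subgroup G} {A : Set X}

/-- `a` is a point of `A`, or the apex of a swallowed pair other than `z`. -/
def IsPointOrOtherApex (δ : ℝ) (R : Set (Subgroup G × X)) (L : Subgroup G) (A : Set X)
    (z : Subgroup G × X) (a : X) : Prop :=
  a ∈ A ∨ ∃ q ∈ nearPairs δ R L A, q ≠ z ∧ q.2 = a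

/-- Seen from a rotation apex, apices of swallowed pairs are hidden behind points of `A`. -/
theorem le_gromovProduct_of_isPointOrOtherApex
    (hR : IsRotationFamily σ R) (hδ : IsHyperbolic X δ)
    (h0 : 0 < δ) (hσ : 1000 * δ ≤ σ) {z : Subgroup G × X} (hz : z ∈ R) {r : ℝ} (hr : r ≤ 100 * δ)
    (hA : ∀ a ∈ A, ∀ b ∈ A, r ≤ gromovProduct a b z.2) {a b : X}
    (ha : IsPointOrOtherApex δ R L A z a) (hb : IsPointOrOtherApex δ R L A z b) :
    r - 2 * δ ≤ gromovProduct a b z.2 := by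
  -- An apex `q` within $100\delta$ of $[d,e]$ but $\sigma$ away from `z` has, seen from `z`, the
  -- direction of `d` or of `e`, which can replace it at the cost of one $\delta$.
  have key {u : X} (hu : IsPointOrOtherApex δ R L A z u) {s : ℝ} (hs : s ≤ 100 * δ) {c : X}
      (hc : ∀ d ∈ A, s ≤ gromovProduct d c z.2) : s - δ ≤ gromovProduct u c z.2 := by
    rcases hu with hu | ⟨q, ⟨hqR, _, d, hd, e, he, hde⟩, hqz, rfl⟩
    · linarith [hc u hu]
    · have hfar := hR.apices_apart q hqR z hz hqz
      rcases hδ.exists_shadow hde.le z.2 with h | h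
      · have := hc d hd
        rcases hδ.le_or_le q.2 d c z.2 with h' | h' <;> linarith
      · have := hc e he
        rcases hδ.le_or_le q.2 e c z.2 with h' | h' <;> linarith
  have h1 : ∀ d ∈ A, r - δ ≤ gromovProduct d b z.2 := fun d hd => by
    rw [gromovProduct_comm]
    exact key hb hr fun e he => hA e he d hd
  have := key ha (s := r - δ) (by linarith) h1
  linarith

theorem IsWindmill.le_gromovProduct (hW : IsWindmill δ R L A) (hR : IsRotationFamily σ R)
    (hδ : IsHyperbolic X δ) (h0 : 0 < δ) (hσ : 1000 * δ ≤ σ) {p : Subgroup G × X}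
    (hp : p ∈ nearPairs δ R L A) {a b : X} (ha : IsPointOrOtherApex δ R L A p a)
    (hb : IsPointOrOtherApex δ R L A p b) : 38 * δ ≤ gromovProduct a b p.2 := by
  have := le_gromovProduct_of_isPointOrOtherApex hR hδ h0 hσ hp.1 (r := 40 * δ) (by linarith)
    ((hW.le_or_far p hp.1).resolve_left hp.2.1) ha hb
  linarith

variable [IsIsometricSMul G X]

/-- The product vanishes within $\sigma/10$ of the apex. A farther `y` is compared with a point at
distance $\sigma/10$ almost on the way to it, `y` and its image costing one $\delta$ each. -/
theorem IsRotationFamily.gromovProduct_smul_self_le (hR : IsRotationFamily σ R)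
    (hX : IsLengthSpace X) (hδ : IsHyperbolic X δ) (h0 : 0 < δ) (hσ : 1000 * δ ≤ σ)
    {p : Subgroup G × X} (hp : p ∈ R) {h : G} (hh : h ∈ p.1) (h1 : h ≠ 1) (y : X) :
    gromovProduct y (h • y) p.2 ≤ 2 * δ := by
  have hfix := hR.smul_apex hp hh
  have hdist (x : X) : dist (h • x) p.2 = dist x p.2 := by
    conv_lhs => rw [← hfix, dist_smul]
  have hzero (x : X) (hx : dist x p.2 ≤ σ / 10) : gromovProduct x (h • x) p.2 = 0 := by
    have := hR.large_angle p hp x hx h hh h1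
    rw [dist_comm, dist_comm p.2] at this
    rw [gromovProduct, hdist, this]
    ring
  rcases le_total (dist y p.2) (σ / 10) with hy | hy
  · rw [hzero y hy]; linarith
  · rw [dist_comm] at hy
    obtain ⟨q, hq, hqy⟩ := hX.exists_between p.2 y (t := σ / 10) (by linarith) hy h0
    rw [dist_comm] at hq
    have hz := hzero q hq.le
    have hyq : σ / 10 - δ ≤ gromovProduct y q p.2 := by
      rw [gromovProduct, hq, dist_comm y, dist_comm y]
      linarith
    have hyq' : gromovProduct (h • y) (h • q) p.2 = gromovProduct y q p.2 := by
      conv_lhs => rw [← hfix, gromovProduct_smul]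
    rw [gromovProduct_comm] at hyq
    rcases hδ.le_or_le q y (h • q) p.2 with h' | h'
    · linarith
    · rw [gromovProduct_comm q y] at hyq
      rcases hδ.le_or_le y (h • y) (h • q) p.2 with h'' | h'' <;> linarith

/-- Rotations turn by a large angle: a direction and its image cannot both be close to a third
one. -/
theorem IsRotationFamily.gromovProduct_smul_le (hR : IsRotationFamily σ R)
    (hX : IsLengthSpace X) (hδ : IsHyperbolic X δ) (h0 : 0 < δ) (hσ : 1000 * δ ≤ σ)
    {p : Subgroup G × X} (hp : p ∈ R) {h : G} (hh : h ∈ p.1) (h1 : h ≠ 1) {x y : X}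
    (hxy : 3 * δ < gromovProduct x y p.2) :
    gromovProduct x (h • y) p.2 ≤ 3 * δ := by
  have := hR.gromovProduct_smul_self_le hX hδ h0 hσ hp hh h1 y
  rw [gromovProduct_comm] at hxy
  rcases hδ.le_or_le y x (h • y) p.2 with h' | h' <;> linarith

theorem IsWindmill.conjPair_mem_nearPairs (hW : IsWindmill δ R L A) (hR : IsRotationFamily σ R)
    {w : G} (hw : w ∈ L) {p : Subgroup G × X} (hp : p ∈ nearPairs δ R L A) :
    conjPair w p ∈ nearPairs δ R L A := by
  obtain ⟨hpR, hpL, a, ha, b, hb, hab⟩ := hp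
  refine ⟨hR.conjPair_mem hpR w, fun h => hpL (le_of_conjPair_le hw h), w • a,
    hW.smul_mem w hw a ha, w • b, hW.smul_mem w hw b hb, ?_⟩
  rwa [conjPair, gromovProduct_smul]

/-- A geodesic from `a` to `g • q` passes close to the first apex of the reduced word `g`. -/
theorem ReducedWord.gromovProduct_le (hX : IsLengthSpace X) (hW : IsWindmill δ R L A)
    (hR : IsRotationFamily σ R) (hδ : IsHyperbolic X δ) (h0 : 0 < δ) (hσ : 1000 * δ ≤ σ)
    {p : Subgroup G × X} {g : G} (hg : ReducedWord L (nearPairs δ R L A) p g) {q : X} (hq : q ∈ A)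
    {a : X} (ha : IsPointOrOtherApex δ R L A p a) : gromovProduct a (g • q) p.2 ≤ 3 * δ := by
  induction hg generalizing a with
  | @single p h w hp hh h1 hw =>
    rw [mul_smul]
    refine hR.gromovProduct_smul_le hX hδ h0 hσ hp.1 hh h1 ?_
    have := hW.le_gromovProduct hR hδ h0 hσ hp ha (Or.inl (hW.smul_mem w hw q hq))
    linarith
  | @cons p h p' g hp hh h1 hne hg ih =>
    rw [mul_smul]
    refine hR.gromovProduct_smul_le hX hδ h0 hσ hp.1 hh h1 ?_
    have hfar := hR.apices_apart _ hg.mem.1 _ hp.1 hne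
    -- The way from `p.2` to `g • q` passes near `p'.2`, at least $\sigma$ away, so from `p.2` both
    -- have the same direction. As $[a,p']$ stays $38\delta$ away from `p.2`, so does $[a,gq]$ up to
    -- $\delta$, before `h` turns it.
    have h2 := ih (a := p.2) (Or.inr ⟨p, hp, hne.symm, rfl⟩)
    have h3 := gromovProduct_add_gromovProduct p'.2 (g • q) p.2
    have h4 := hW.le_gromovProduct hR hδ h0 hσ hp ha (b := p'.2) (Or.inr ⟨p', hg.mem, hne, rfl⟩)
    rcases hδ.le_or_le a p'.2 (g • q) p.2 with h' | h' <;> linarith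

theorem ReducedWord.lt_dist_smul (hX : IsLengthSpace X) (hW : IsWindmill δ R L A)
    (hR : IsRotationFamily σ R) (hδ : IsHyperbolic X δ) (h0 : 0 < δ) (hσ : 1000 * δ ≤ σ)
    {p : Subgroup G × X} {g : G} (hg : ReducedWord L (nearPairs δ R L A) p g)
    {c : Subgroup G × X} (hc : c ∈ R) (hcA : c.2 ∈ A) : σ < dist (g • c.2) c.2 := by
  have h1 := hg.gromovProduct_le hX hW hR hδ h0 hσ hcA (Or.inl hcA)
  have hAp (b : X) (hb : b ∈ A) : 38 * δ ≤ dist b p.2 := by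
    simpa using hW.le_gromovProduct hR hδ h0 hσ hg.mem (Or.inl hb) (Or.inl hb)
  have hcp : c ≠ p := by
    rintro rfl
    have := hAp _ hcA
    rw [dist_self] at this
    linarith
  have hfar := hR.apices_apart c hc p hg.mem.1 hcp
  -- Passing within $3\delta$ of `p.2` costs $6\delta$ in length, which the distance from `p.2` to
  -- the endpoint must outweigh.
  have h2 : 38 * δ ≤ dist (g • c.2) p.2 := by
    cases hg with
    | @single _ h w hp hh _ hw =>
      rw [mul_smul]
      conv_rhs => rw [← hR.smul_apex hp.1 hh, dist_smul]
      exact hAp _ (hW.smul_mem w hw _ hcA)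
    | @cons _ h p' g hp hh _ hne hg =>
      rw [mul_smul]
      conv_rhs => rw [← hR.smul_apex hp.1 hh, dist_smul]
      have h3 := hg.gromovProduct_le hX hW hR hδ h0 hσ hcA (a := p.2)
        (Or.inr ⟨p, hp, hne.symm, rfl⟩)
      have hfar := hR.apices_apart _ hp.1 _ hg.mem.1 hne.symm
      rw [gromovProduct] at h3
      have := dist_nonneg (x := g • c.2) (y := p'.2)
      rw [dist_comm (g • c.2) p.2]
      linarith
  rw [gromovProduct] at h1
  rw [dist_comm (g • c.2) c.2]
  linarith

/-- The apices that are not swallowed are far from the geodesics from `P` to `g • q`, where `g` is a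
reduced word. In the induction `a` is the last apex that was passed on the way. -/
theorem ReducedWord.lt_gromovProduct (hX : IsLengthSpace X) (hW : IsWindmill δ R L A)
    (hR : IsRotationFamily σ R) (hδ : IsHyperbolic X δ) (h0 : 0 < δ) (hσ : 1000 * δ ≤ σ)
    {p : Subgroup G × X} {g : G} (hg : ReducedWord L (nearPairs δ R L A) p g) {q : X} (hq : q ∈ A)
    {z : Subgroup G × X} (hz : z ∈ R) (hzL : ¬ z.1 ≤ nextSubgroup L (nearPairs δ R L A))
    {P a : X} (ha : IsPointOrOtherApex δ R L A p a)
    (haP : a = P ∨ (∃ c ∈ nearPairs δ R L A, c ≠ p ∧ c.2 = a) ∧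
      gromovProduct P (g • q) a ≤ 4 * δ)
    (haz : gromovProduct a (g • q) z.2 ≤ 96 * δ) :
    95 * δ < gromovProduct P (g • q) z.2 := by
  -- An unswallowed apex is $100\delta$ away from geodesics of `A`; replacing endpoints by swallowed
  -- apices costs $2\delta$.
  have far {z : Subgroup G × X} (hz : z ∈ R)
      (hzL : ¬ z.1 ≤ nextSubgroup L (nearPairs δ R L A)) :
      ∀ {a b : X} {p p' : Subgroup G × X}, IsPointOrOtherApex δ R L A p a →
        IsPointOrOtherApex δ R L A p' b → 98 * δ ≤ gromovProduct a b z.2 := by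
    intro a b p p' ha hb
    have hzN (c) (hc : c ∈ nearPairs δ R L A) : c ≠ z := by
      rintro rfl
      exact hzL (le_nextSubgroup_of_mem L hc)
    have hvis {a : X} {p : Subgroup G × X} (ha : IsPointOrOtherApex δ R L A p a) :
        IsPointOrOtherApex δ R L A z a :=
      ha.imp_right fun ⟨c, hc, _, h⟩ => ⟨c, hc, hzN c hc, h⟩
    have := le_gromovProduct_of_isPointOrOtherApex hR hδ h0 hσ hz le_rfl (fun a ha b hb => by
      by_contra hlt
      exact hzN z ⟨hz, fun h => hzL (h.trans (le_nextSubgroup _ _)), a, ha, b, hb, not_le.1 hlt⟩ rfl)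
      (hvis ha) (hvis hb)
    linarith
  have hconj {z : Subgroup G × X} (hzL : ¬ z.1 ≤ nextSubgroup L (nearPairs δ R L A))
      {h : G} (hh : h ∈ nextSubgroup L (nearPairs δ R L A)) :
      ¬ (conjPair h⁻¹ z).1 ≤ nextSubgroup L (nearPairs δ R L A) :=
    fun h' => hzL (le_of_conjPair_le (inv_mem hh) h')
  -- The bend at `p` persists when the start is moved back from the apex `a` to `P`: since $[P,gq]$
  -- passes near `a`, both `a` and `P` have the same direction seen from `p`.
  have fold {p : Subgroup G × X} {g : G} (hg : ReducedWord L (nearPairs δ R L A) p g) {P a : X}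
      (ha : IsPointOrOtherApex δ R L A p a)
      (haP : a = P ∨ (∃ c ∈ nearPairs δ R L A, c ≠ p ∧ c.2 = a) ∧
        gromovProduct P (g • q) a ≤ 4 * δ) : gromovProduct P (g • q) p.2 ≤ 4 * δ := by
    have h1 := hg.gromovProduct_le hX hW hR hδ h0 hσ hq ha
    rcases haP with rfl | ⟨⟨c, hc, hcp, rfl⟩, hP⟩
    · linarith
    have hfar := hR.apices_apart c hc.1 p hg.mem.1 hcp
    have h2 := gromovProduct_add_gromovProduct c.2 (g • q) p.2
    have h3 := gromovProduct_add_gromovProduct c.2 P p.2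
    rw [gromovProduct_comm p.2 P] at h3
    rcases hδ.le_or_le P p.2 (g • q) c.2 with h' | h'
    · rcases hδ.le_or_le c.2 P (g • q) p.2 with h'' | h'' <;> linarith
    · linarith
  -- If `z` were near $[P,gq]$ but not near $[p,gq]$, it would be near $[P,p]$, hence near $[P,a]$,
  -- since `far` keeps it off $[a,p]$. Being also near $[a,gq]$ and $\sigma$ away from `a`, it would
  -- contradict the passage of $[P,gq]$ near `a`.
  have hpass {p : Subgroup G × X} {g : G} (hg : ReducedWord L (nearPairs δ R L A) p g) {P a : X}
      {z : Subgroup G × X} (hz : z ∈ R) (hzL : ¬ z.1 ≤ nextSubgroup L (nearPairs δ R L A))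
      (ha : IsPointOrOtherApex δ R L A p a)
      (haP : a = P ∨ (∃ c ∈ nearPairs δ R L A, c ≠ p ∧ c.2 = a) ∧
        gromovProduct P (g • q) a ≤ 4 * δ)
      (haz : gromovProduct a (g • q) z.2 ≤ 96 * δ)
      (hP : gromovProduct P (g • q) z.2 ≤ 95 * δ) : gromovProduct p.2 (g • q) z.2 ≤ 96 * δ := by
    by_contra! hlt
    have hPp : gromovProduct P p.2 z.2 ≤ 96 * δ := by
      rcases hδ.le_or_le P p.2 (g • q) z.2 with h' | h' <;> linarith
    have hap : 98 * δ ≤ gromovProduct a p.2 z.2 :=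
      far hz hzL (p' := z) ha (Or.inr ⟨p, hg.mem,
        fun h => hzL (h ▸ le_nextSubgroup_of_mem L hg.mem), rfl⟩)
    rcases haP with rfl | ⟨⟨c, hc, hcp, rfl⟩, hPa⟩
    · linarith
    have hcz : c ≠ z := fun h => hzL (h ▸ le_nextSubgroup_of_mem L hc)
    have hfar := hR.apices_apart c hc.1 z hz hcz
    have h1 : gromovProduct P c.2 z.2 ≤ 97 * δ := by
      rcases hδ.le_or_le P c.2 p.2 z.2 with h' | h' <;> linarith
    have h2 := gromovProduct_add_gromovProduct c.2 P z.2
    have h3 := gromovProduct_add_gromovProduct c.2 (g • q) z.2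
    rw [gromovProduct_comm c.2 P, gromovProduct_comm z.2 P] at h2
    rcases hδ.le_or_le P z.2 (g • q) c.2 with h' | h' <;> linarith
  by_contra! hP
  have hpz := hpass hg hz hzL ha haP haz hP
  -- Undoing the first rotation by `h⁻¹` fixes `p.2` and shortens the word. So `z`, up to
  -- translation, is pushed along the path to its last piece, where `far` excludes it.
  induction hg generalizing P a z with
  | @single p h w hp hh h1 hw =>
    have hh' := le_nextSubgroup_of_mem L hp hh
    rw [mul_smul, gromovProduct_comm, gromovProduct_smul_eq,
      hR.smul_apex hp.1 (inv_mem hh)] at hpz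
    have hpz' := far (hR.conjPair_mem hz h⁻¹) (hconj hzL hh') (p := p) (p' := conjPair h⁻¹ z)
      (Or.inl (hW.smul_mem w hw q hq)) (Or.inr ⟨p, hp,
        fun h => hconj hzL hh' (h ▸ le_nextSubgroup_of_mem L hp), rfl⟩)
    simp only [conjPair] at hpz'
    linarith
  | @cons p h p' g hp hh h1 hne hg ih =>
    have hh' := le_nextSubgroup_of_mem L hp hh
    have hf := fold (.cons hp hh h1 hne hg) ha haP
    rw [mul_smul, gromovProduct_comm, gromovProduct_smul_eq,
      hR.smul_apex hp.1 (inv_mem hh), gromovProduct_comm] at hpz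
    rw [mul_smul, gromovProduct_comm, gromovProduct_smul_eq,
      hR.smul_apex hp.1 (inv_mem hh), gromovProduct_comm] at hf
    rw [mul_smul, gromovProduct_comm, gromovProduct_smul_eq, gromovProduct_comm] at hP
    have hvis : IsPointOrOtherApex δ R L A p' p.2 := Or.inr ⟨p, hp, hne.symm, rfl⟩
    have haP' : p.2 = h⁻¹ • P ∨ (∃ c ∈ nearPairs δ R L A, c ≠ p' ∧ c.2 = p.2) ∧
        gromovProduct (h⁻¹ • P) (g • q) p.2 ≤ 4 * δ := Or.inr ⟨⟨p, hp, hne.symm, rfl⟩, hf⟩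
    exact ih (hR.conjPair_mem hz h⁻¹) (hconj hzL hh') hvis haP' hpz hP
      (hpass hg (hR.conjPair_mem hz h⁻¹) (hconj hzL hh') hvis haP' hpz hP)

/-! ### Growth of windmills and exhaustion. -/

/-- The set of the next windmill. -/
def nextSet (δ : ℝ) (L : Subgroup G) (A : Set X) : Set X :=
  {x | ∃ g ∈ L, ∃ a ∈ A, dist x (g • a) ≤ 20 * δ}

theorem IsWindmill.next (hX : IsLengthSpace X) (hW : IsWindmill δ R L A)
    (hR : IsRotationFamily σ R) (hδ : IsHyperbolic X δ) (h0 : 0 < δ) (hσ : 1000 * δ ≤ σ) :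
    IsWindmill δ R (nextSubgroup L (nearPairs δ R L A))
      (nextSet δ (nextSubgroup L (nearPairs δ R L A)) A) where
  smul_mem := by
    rintro g hg x ⟨k, hk, a, ha, hx⟩
    exact ⟨g * k, mul_mem hg hk, a, ha, by rwa [mul_smul, dist_smul]⟩
  le_or_far := by
    intro z hz
    refine or_iff_not_imp_left.2 fun hzL => ?_
    rintro x ⟨k, hk, a, ha, hx⟩ y ⟨l, hl, b, hb, hy⟩
    have h1 := gromovProduct_sub_dist_le (k • a) (l • b) x y z.2
    rw [gromovProduct_smul_eq, ← mul_smul] at h1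
    have hz' := hR.conjPair_mem hz k⁻¹
    have hzL' : ¬ (conjPair k⁻¹ z).1 ≤ nextSubgroup L (nearPairs δ R L A) :=
      fun h => hzL (le_of_conjPair_le (inv_mem hk) h)
    -- Moving the endpoints to `x` and `y` loses $20\delta$ each, which leaves $55\delta$, more than
    -- the required $40\delta$.
    have h2 : 95 * δ ≤ gromovProduct a ((k⁻¹ * l) • b) (conjPair k⁻¹ z).2 := by
      rcases mem_or_reducedWord (fun w hw p hp => hW.conjPair_mem_nearPairs hR hw hp)
        (mul_mem (inv_mem hk) hl) with hkl | ⟨p, hkl⟩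
      · by_contra! hlt
        refine hzL' (le_nextSubgroup_of_mem L ⟨hz', fun h => hzL' (h.trans (le_nextSubgroup _ _)),
          a, ha, _, hW.smul_mem _ hkl b hb, ?_⟩)
        linarith
      · by_contra! hlt
        have := hkl.lt_gromovProduct hX hW hR hδ h0 hσ hb hz' hzL' (P := a) (Or.inl ha)
          (Or.inl rfl) (by linarith)
        linarith
    simp only [conjPair] at h2
    linarith

theorem IsRotationFamily.exists_windmill (hX : IsLengthSpace X) (hR : IsRotationFamily σ R)
    (hδ : IsHyperbolic X δ) (h0 : 0 < δ) (hσ : 1000 * δ ≤ σ) {c : Subgroup G × X} (hc : c ∈ R)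
    (n : ℕ) : ∃ (L : Subgroup G) (A : Set X), IsWindmill δ R L A ∧
      Metric.closedBall c.2 (n * (10 * δ)) ⊆ A ∧
      ∀ g ∈ L, g ∈ c.1 ∨ σ < dist (g • c.2) c.2 := by
  induction n with
  | zero =>
    refine ⟨c.1, {c.2}, ⟨?_, ?_⟩, by simp, fun g hg => Or.inl hg⟩
    · rintro g hg a rfl
      exact hR.smul_apex hc hg
    · intro p hp
      by_cases hpc : c = p
      · left; rw [hpc]
      · right
        rintro a rfl b rfl
        have := hR.apices_apart c hc p hp hpc
        rw [gromovProduct_self]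
        linarith
  | succ n ih =>
    obtain ⟨L, A, hW, hA, hL⟩ := ih
    have hn : (0 : ℝ) ≤ n * (10 * δ) := by positivity
    refine ⟨_, _, hW.next hX hR hδ h0 hσ, ?_, ?_⟩
    · intro x hx
      rw [Metric.mem_closedBall, dist_comm] at hx
      push_cast at hx
      obtain ⟨y, hy, hyx⟩ : ∃ y, dist c.2 y ≤ n * (10 * δ) ∧ dist y x ≤ 20 * δ := by
        rcases le_total (dist c.2 x) (n * (10 * δ)) with h | h
        · exact ⟨x, h, by simp; linarith⟩
        · obtain ⟨y, hy, hyx⟩ := hX.exists_between c.2 x hn h h0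
          exact ⟨y, hy.le, by linarith⟩
      refine ⟨1, one_mem _, y, hA (by rwa [Metric.mem_closedBall, dist_comm]), ?_⟩
      rwa [one_smul, dist_comm]
    · intro g hg
      rcases mem_or_reducedWord (fun w hw p hp => hW.conjPair_mem_nearPairs hR hw hp) hg with
        hg | ⟨p, hg⟩
      · exact hL g hg
      · exact Or.inr (hg.lt_dist_smul hX hW hR hδ h0 hσ hc
          (hA (Metric.mem_closedBall_self hn)))

theorem IsRotationFamily.mem_or_lt_dist (hX : IsLengthSpace X) (hR : IsRotationFamily σ R)
    (hδ : IsHyperbolic X δ) (h0 : 0 < δ) (hσ : 1000 * δ ≤ σ) {c : Subgroup G × X} (hc : c ∈ R)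
    {g : G} (hg : g ∈ rotationSubgroup R) : g ∈ c.1 ∨ σ < dist (g • c.2) c.2 := by
  -- `g` is a product of finitely many rotations, whose apices lie in some ball around `c.2`.
  obtain ⟨r, hr⟩ : ∃ r : ℝ, ∀ L : Subgroup G,
      (∀ p ∈ R, dist p.2 c.2 ≤ r → p.1 ≤ L) → g ∈ L := by
    induction hg using Subgroup.closure_induction with
    | mem x hx =>
      simp only [Set.mem_iUnion] at hx
      obtain ⟨p, hp, hx⟩ := hx
      exact ⟨_, fun L hL => hL p hp le_rfl hx⟩
    | one => exact ⟨0, fun L _ => L.one_mem⟩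
    | mul x y _ _ hx hy =>
      obtain ⟨r, hr⟩ := hx
      obtain ⟨s, hs⟩ := hy
      exact ⟨max r s, fun L hL => L.mul_mem
        (hr L fun p hp h => hL p hp (h.trans (le_max_left _ _)))
        (hs L fun p hp h => hL p hp (h.trans (le_max_right _ _)))⟩
    | inv x _ hx =>
      obtain ⟨r, hr⟩ := hx
      exact ⟨r, fun L hL => L.inv_mem (hr L hL)⟩
  obtain ⟨n, hn⟩ := exists_nat_ge (r / (10 * δ))
  rw [div_le_iff₀ (by positivity)] at hn
  obtain ⟨L, A, hW, hA, hL⟩ := hR.exists_windmill hX hδ h0 hσ hc n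
  -- An apex belonging to `A` cannot be far from geodesics of `A`: $\langle p,p\rangle_p=0$.
  refine hL g (hr L fun p hp hpr => (hW.le_or_far p hp).resolve_right fun h => ?_)
  have hpA : p.2 ∈ A := hA (hpr.trans hn)
  have := h p.2 hpA p.2 hpA
  rw [gromovProduct_self, dist_self] at this
  linarith

end Rotation

end RotationFamilies

theorem mainTheorem2 (δ : ℝ) (hδ : 0 < δ) :
    ∃ σ₀ : ℝ, 0 < σ₀ ∧
      ∀ (G : Type*) (X : Type*) [Group G] [MetricSpace X] [MulAction G X] [IsIsometricSMul G X],
        RotationFamilies.IsLengthSpace X → RotationFamilies.IsHyperbolic X δ →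
        ∀ (σ : ℝ), σ₀ ≤ σ →
        ∀ (R : Set (Subgroup G × X)), RotationFamilies.IsRotationFamily σ R →
        ∀ (H : Subgroup G) (v : X), (H, v) ∈ R →
          MulAction.stabilizer G v ⊓ RotationFamilies.rotationSubgroup R = H ∧
          ∀ x ∈ Metric.closedBall v (σ / 5), ∀ g ∈ RotationFamilies.rotationSubgroup R, g ∉ H →
            3 * σ / 5 < dist (g • x) x := by
  refine ⟨1000 * δ, by positivity, ?_⟩
  intro G X _ _ _ _ hX hyp σ hσ R hR H v hv
  have key (g : G) (hg : g ∈ RotationFamilies.rotationSubgroup R) :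
      g ∈ H ∨ σ < dist (g • v) v := hR.mem_or_lt_dist hX hyp hδ hσ hv hg
  refine ⟨le_antisymm ?_ ?_, ?_⟩
  · rintro g ⟨hgv, hg⟩
    refine (key g hg).resolve_right fun h => ?_
    rw [MulAction.mem_stabilizer_iff.1 hgv, dist_self] at h
    linarith
  · exact le_inf (hR.le_stabilizer _ hv)
      fun h hh => Subgroup.subset_closure (Set.mem_biUnion hv hh)
  · intro x hx g hg hgH
    have h1 := (key g hg).resolve_left hgH
    rw [Metric.mem_closedBall] at hx
    -- Going from `v` to `x` changes the displacement by at most $2\sigma/5$.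
    have h2 := dist_triangle4 (g • v) (g • x) x v
    rw [dist_smul, dist_comm v x] at h2
    linarith
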